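/- Setting. Let $(M,d)$ be a complete metric space and $1\le p<\infty$. Let $\mathcal P^p(M)$ be the set of Borel probability measures $\mu$ on $M$ with $\mu(\operatorname{supp}\mu)=1$ and $\int_M d(x,y)^p\,d\mu(y)<\infty$ for some $x\in M$. For $\mu,\nu\in\mathcal P^p(M)$ let $$d_p^W(\mu,\nu)=\Bigl[\inf_{\pi\in\Pi(\mu,\nu)}\int_{M\times M}d(x,y)^p\,d\pi(x,y)\Bigr]^{1/p},$$ where $\Pi(\mu,\nu)$ is the set of Borel probability measures $\pi$ on $M\times M$ with $\pi(\operatorname{supp}\pi)=1$ and marginals $\mu$ and $\nu$. A map $\beta:\mathcal P^p(M)\to M$ is a $p$-contractive barycentric map if $\beta(\delta_x)=x$ for all $x\in M$ and $d(\beta(\mu),\beta(\nu))\le d_p^W(\mu,\nu)$ for all $\mu,\nu\in\mathcal P^p(M)$. For a probability space $(\Omega,\mathcal A,\mathbf P)$, $L^p(\Omega,\mathcal A,\mathbf P;M)$ denotes the set of (classes modulo a.e. equality of) strongly measurable functions $\varphi:\Omega\to M$ (a.e. limits of $\mathcal A$-measurable simple functions) with $\int_\Omega d(x,\varphi(\omega))^p\,d\mathbf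 P(\omega)<\infty$ for some $x\in M$; its metric is $\mathbf d_p(\varphi,\psi)=\bigl[\int_\Omega d(\varphi(\omega),\psi(\omega))^p\,d\mathbf P(\omega)\bigr]^{1/p}$. If $\mathcal B\subset\mathcal A$ is a sub-$\sigma$-algebra, a disintegration of $\mathbf P$ with respect to $\mathcal B$ is a family $(\mathbf P_\omega)_{\omega\in\Omega}$ of probability measures on $(\Omega,\mathcal A)$ such that, for every $A\in\mathcal A$, the function $\omega\mapsto\mathbf P_\omega(A)$ is $\mathcal B$-measurable and is a conditional expectation of $\mathbf 1_A$ with respect to $\mathcal B$. If $(\Omega,\mathcal A)$ is a standard Borel space, then such a family exists and is unique up to a $\mathbf P$-null set, and the $\beta$-conditional expectation of $\varphi\in L^p(\Omega,\mathcal A,\mathbf P;M)$ is $$E^\beta_{\mathcal B}(\varphi)(\omega)=\beta(\varphi_*\mathbf P_\omega),$$ which is defined for $\mathbf P$-a.e. $\omega$ (on the exceptional null set any values may be taken). Theorem 3.1. Let $(\Omega,\mathcal A,\mathbf P)$ be a standard Borel probability space. Let $(\mathcal B_n)_{n\in\mathbb N}$ be a sequence of sub-$\sigma$-algebras of $\mathcal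 A$ which is either increasing, with $\mathcal B_\infty=\sigma\bigl(\bigcup_n\mathcal B_n\bigr)$, or decreasing, with $\mathcal B_\infty=\bigcap_n\mathcal B_n$. Let $1\le p<\infty$ and let $\beta:\mathcal P^p(M)\to M$ be a $p$-contractive barycentric map. Then for every $\varphi\in L^p(\Omega,\mathcal A,\mathbf P;M)$ we have $E^\beta_{\mathcal B_n}(\varphi)\in L^p(\Omega,\mathcal B_n,\mathbf P;M)$ for all $n\in\mathbb N\cup\{\infty\}$, and, as $n\to\infty$, $$\mathbf d_p\bigl(E^\beta_{\mathcal B_n}(\varphi),E^\beta_{\mathcal B_\infty}(\varphi)\bigr)\longrightarrow0 \quad\text{and}\quad d\bigl(E^\beta_{\mathcal B_n}(\varphi)(\omega),E^\beta_{\mathcal B_\infty}(\varphi)(\omega)\bigr)\longrightarrow0\ \text{ for a.e. }\omega .$$ -/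

import Mathlib

open MeasureTheory Filter Topology
open scoped ENNReal

noncomputable section

namespace Barycentric

/-- Borel probability measures that are carried by their topological support, `μ (supp μ) = 1`.
(On a non-separable space this is a genuine restriction.) -/
structure IsFullySupported {X : Type*} [TopologicalSpace X] [MeasurableSpace X]
    (μ : Measure X) : Prop where
  isProbabilityMeasure : IsProbabilityMeasure μ
  measure_compl_support : μ μ.supportᶜ = 0

/-- The set `𝒫^p(M)` of fully supported Borel probability measures `μ` on `M` with
`∫ d(x, y)^p dμ(y) < ∞` for some `x`. -/
def PMeasures (M : Type*) [MetricSpace M] [MeasurableSpace M] (p : ℝ) : Set (Measure M) :=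
  {μ | IsFullySupported μ ∧ ∃ x : M, ∫⁻ y, edist x y ^ p ∂μ < ∞}

/-- The couplings of `μ` and `ν`: fully supported probability measures on the Borel
`σ`-algebra of `M × M` (which may be larger than the product `σ`-algebra if `M` is not
separable) with marginals `μ` and `ν`. -/
def couplings {M : Type*} [MetricSpace M] [MeasurableSpace M] (μ ν : Measure M) :
    Set (@Measure (M × M) (borel (M × M))) :=
  letI : MeasurableSpace (M × M) := borel (M × M)
  {π | IsFullySupported π ∧
    ∀ B : Set M, MeasurableSet B → π (B ×ˢ Set.univ) = μ B ∧ π (Set.univ ×ˢ B) = ν B}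

/-- The `p`-Wasserstein distance, as an extended nonnegative real. -/
def wasserstein {M : Type*} [MetricSpace M] [MeasurableSpace M] (p : ℝ) (μ ν : Measure M) :
    ℝ≥0∞ :=
  letI : MeasurableSpace (M × M) := borel (M × M)
  (⨅ π ∈ couplings μ ν, ∫⁻ z : M × M, edist z.1 z.2 ^ p ∂π) ^ (1 / p)

/-- `β` is a `p`-contractive barycentric map `𝒫^p(M) → M`. Only the values of `β` on `𝒫^p(M)`
are constrained; outside of it `β` is arbitrary. -/
structure IsContractiveBarycentricMap {M : Type*} [MetricSpace M] [MeasurableSpace M]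
    (p : ℝ) (β : Measure M → M) : Prop where
  map_dirac : ∀ x : M, β (Measure.dirac x) = x
  contractive : ∀ μ ∈ PMeasures M p, ∀ ν ∈ PMeasures M p,
    edist (β μ) (β ν) ≤ wasserstein p μ ν

/-- `φ ∈ L^p(Ω; M)`: `φ` is strongly measurable (up to a null set) and
`∫ d(x, φ)^p dP < ∞` for some `x`. -/
def MemLpMetric {Ω M : Type*} {m : MeasurableSpace Ω} [MetricSpace M]
    (p : ℝ) (P : Measure Ω) (φ : Ω → M) : Prop :=
  AEStronglyMeasurable φ P ∧ ∃ x : M, ∫⁻ ω, edist x (φ ω) ^ p ∂P < ∞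

/-- The `L^p`-distance of two `M`-valued functions, as an extended nonnegative real. -/
def lpDist {Ω M : Type*} {m : MeasurableSpace Ω} [MetricSpace M]
    (p : ℝ) (P : Measure Ω) (φ ψ : Ω → M) : ℝ≥0∞ :=
  (∫⁻ ω, edist (φ ω) (ψ ω) ^ p ∂P) ^ (1 / p)

/-- `(Q ω)` is a disintegration of `P` with respect to the sub-`σ`-algebra `𝓑`: a family of
probability measures such that, for every event `A`, the function `ω ↦ Q ω A` is
`𝓑`-measurable and is a conditional expectation of the indicator of `A` given `𝓑`. -/
structure IsDisintegration {Ω : Type*} (𝓑 : MeasurableSpace Ω) [mΩ : MeasurableSpace Ω]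
    (P : Measure Ω) (Q : Ω → Measure Ω) : Prop where
  isProbabilityMeasure : ∀ ω, IsProbabilityMeasure (Q ω)
  measurable : ∀ A : Set Ω, MeasurableSet A → Measurable[𝓑] fun ω => Q ω A
  ae_eq_condExp : ∀ A : Set Ω, MeasurableSet A →
    (fun ω => (Q ω).real A) =ᵐ[P] P[A.indicator (fun _ => (1 : ℝ)) | 𝓑]

/-- Disintegrations exist on standard Borel probability spaces. -/
theorem isDisintegration_condExpKernel {Ω : Type*} {𝓑 : MeasurableSpace Ω}
    [mΩ : MeasurableSpace Ω] [StandardBorelSpace Ω] (P : Measure Ω) [IsProbabilityMeasure P]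
    (h : 𝓑 ≤ mΩ) :
    IsDisintegration 𝓑 P (fun ω => ProbabilityTheory.condExpKernel P 𝓑 ω) where
  isProbabilityMeasure _ := inferInstance
  measurable _ hA := ProbabilityTheory.measurable_condExpKernel hA
  ae_eq_condExp _ hA := ProbabilityTheory.condExpKernel_ae_eq_condExp h hA

/-- The `β`-conditional expectation `ω ↦ β (φ_* Q_ω)`, with respect to the sub-`σ`-algebra that
the disintegration `Q` belongs to. -/
def condExpectation {Ω M : Type*} [MeasurableSpace Ω] [MeasurableSpace M]
    (β : Measure M → M) (Q : Ω → Measure Ω) (φ : Ω → M) (ω : Ω) : M :=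
  β ((Q ω).map φ)

end Barycentric

end

open Barycentric

/-! If `f` and `g` are pushed forward by the same `Q ω`, the law of `(f, g)` couples the two images,
so contractivity gives `d(E f, E g)^p ≤ ∫ d(f, g)^p ∂Q ω` wherever `f` and `g` have finite `p`-th
moments. Hence `E` is a contraction for `lpDist`, uniformly in the σ-algebra, and its pointwise
error is a real conditional expectation. A simple function reduces the problem to finitely many
fixed points with varying weights `Q n ω (s = y)`. The barycenter is continuous in the weights
(`edist_atomicMeasure_rpow_le`), and the weights converge a.e. by Lévy's theorems. Domination by a
constant yields `L^p` convergence. For general `g`, take simple `s k → g`. In `L^p` the contraction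
suffices. Almost everywhere, the error `∫ d(s k, g)^p ∂Q n ω` converges in `n` by Lévy again, and
its limit, the integral against `Q ⊤ ω`, vanishes as `k → ∞`. Only real-valued martingale theory
enters. -/

namespace Barycentric

/-! ### Lévy's downward theorem for real functions. -/

section ReverseMartingale

variable {Ω : Type*} {mΩ : MeasurableSpace Ω} {P : Measure Ω} {𝓑 : ℕ → MeasurableSpace Ω}

/-- A real function that is a.e. strongly measurable for each member of a decreasing sequence of
`σ`-algebras is so for their intersection. -/
theorem aestronglyMeasurable_iInf (hanti : Antitone 𝓑) {f : Ω → ℝ}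
    (hf : ∀ n, AEStronglyMeasurable[𝓑 n] f P) : AEStronglyMeasurable[⨅ n, 𝓑 n] f P := by
  have hex : ∀ n, ∃ g : Ω → ℝ, Measurable[𝓑 n] g ∧ f =ᵐ[P] g := fun n =>
    ⟨_, (hf n).stronglyMeasurable_mk.measurable, (hf n).ae_eq_mk⟩
  choose g hg hfg using hex
  refine ⟨fun ω => limsup (fun n => g n ω) atTop, ?_, ?_⟩
  · refine Measurable.stronglyMeasurable ?_
    intro s hs
    rw [MeasurableSpace.measurableSet_iInf]
    intro k
    -- The limsup ignores the first `k` terms, and all later ones are `𝓑 k`-measurable.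
    have h1 : Measurable[𝓑 k] fun ω => limsup (fun n => g (n + k) ω) atTop :=
      Measurable.limsup fun n => (hg (n + k)).mono (hanti (Nat.le_add_left k n)) le_rfl
    have h2 : (fun ω => limsup (fun n => g (n + k) ω) atTop) =
        fun ω => limsup (fun n => g n ω) atTop :=
      funext fun ω => limsup_nat_add (fun n => g n ω) k
    rw [h2] at h1
    exact h1 hs
  · filter_upwards [ae_all_iff.2 hfg] with ω hω
    simp [← hω]

/-- In `L²` these are orthogonal projections onto decreasing subspaces `U n` with intersection `V`.
The complements increase, with union dense in `Vᗮ`, so the projections onto them converge. -/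
theorem tendsto_eLpNorm_two_condExp_iInf [IsFiniteMeasure P] (h𝓑 : ∀ n, 𝓑 n ≤ mΩ)
    (hanti : Antitone 𝓑) {f : Ω → ℝ} (hf : MemLp f 2 P) :
    Tendsto (fun n => eLpNorm (P[f | 𝓑 n] - P[f | ⨅ n, 𝓑 n]) 2 P) atTop (𝓝 0) := by
  have hinf : (⨅ n, 𝓑 n) ≤ mΩ := (iInf_le 𝓑 0).trans (h𝓑 0)
  have : ∀ n, Fact (𝓑 n ≤ mΩ) := fun n => ⟨h𝓑 n⟩
  have : Fact ((⨅ n, 𝓑 n) ≤ mΩ) := ⟨hinf⟩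
  let U : ℕ → Submodule ℝ (Lp ℝ 2 P) := fun n => lpMeas ℝ ℝ (𝓑 n) 2 P
  let V : Submodule ℝ (Lp ℝ 2 P) := lpMeas ℝ ℝ (⨅ n, 𝓑 n) 2 P
  have hUcl : ∀ n, (U n).HasOrthogonalProjection := fun n => by
    dsimp only [U]; infer_instance
  have hVcl : V.HasOrthogonalProjection := by dsimp only [V]; infer_instance
  have hUV : ⨅ n, U n = V := by
    ext x
    simp only [Submodule.mem_iInf, U, V, mem_lpMeas_iff_aestronglyMeasurable]
    refine ⟨fun h => aestronglyMeasurable_iInf hanti h, fun h n => h.mono (iInf_le 𝓑 n)⟩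
  have hUanti : Antitone U := fun i j hij x hx => by
    simp only [U, mem_lpMeas_iff_aestronglyMeasurable] at hx ⊢
    exact hx.mono (hanti hij)
  have hmono : Monotone fun n => (U n)ᗮ := fun i j hij => Submodule.orthogonal_le (hUanti hij)
  have hcl : (⨆ n, (U n)ᗮ).topologicalClosure = Vᗮ := by
    rw [← Submodule.orthogonal_orthogonal_eq_closure, ← Submodule.iInf_orthogonal, ← hUV]
    congr 2
    funext n
    exact Submodule.orthogonal_orthogonal (U n)
  have hlim := Submodule.starProjection_tendsto_closure_iSup (fun n => (U n)ᗮ) hmono (hf.toLp f)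
  simp only [hcl, Submodule.starProjection_orthogonal] at hlim
  have hlim2 : Tendsto (fun n => (U n).starProjection (hf.toLp f)) atTop
      (𝓝 (V.starProjection (hf.toLp f))) := by
    have := (tendsto_const_nhds (x := hf.toLp f)).sub hlim
    simpa using this
  rw [Lp.tendsto_Lp_iff_tendsto_eLpNorm'] at hlim2
  refine hlim2.congr fun n => eLpNorm_congr_ae ?_
  exact (hf.condExpL2_ae_eq_condExp (𝕜 := ℝ) (h𝓑 n)).sub
    (hf.condExpL2_ae_eq_condExp (𝕜 := ℝ) hinf)

/-- Simple functions lie in `L²` and are dense in `L¹`, where conditional expectation is a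
contraction. -/
theorem tendsto_eLpNorm_one_condExp_iInf [IsProbabilityMeasure P] (h𝓑 : ∀ n, 𝓑 n ≤ mΩ)
    (hanti : Antitone 𝓑) {f : Ω → ℝ} (hf : Integrable f P) :
    Tendsto (fun n => eLpNorm (P[f | 𝓑 n] - P[f | ⨅ n, 𝓑 n]) 1 P) atTop (𝓝 0) := by
  have hinf : (⨅ n, 𝓑 n) ≤ mΩ := (iInf_le 𝓑 0).trans (h𝓑 0)
  rw [ENNReal.tendsto_nhds_zero]
  intro ε hε
  obtain ⟨g, hg, -⟩ := (memLp_one_iff_integrable.2 hf).exists_simpleFunc_eLpNorm_sub_lt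
    ENNReal.one_ne_top (ε := ε / 3) (by simpa using hε.ne')
  have hg2 : MemLp g 2 P := SimpleFunc.memLp_of_isFiniteMeasure g 2 P
  have hgi : Integrable g P := hg2.integrable one_le_two
  have hsub : ∀ m : MeasurableSpace Ω, eLpNorm (P[f | m] - P[g | m]) 1 P ≤ ε / 3 := fun m => by
    rw [← eLpNorm_congr_ae (condExp_sub hf hgi m)]
    exact (eLpNorm_condExp_le_eLpNorm _ le_rfl).trans hg.le
  filter_upwards [ENNReal.tendsto_nhds_zero.1
    (tendsto_eLpNorm_two_condExp_iInf h𝓑 hanti hg2) (ε / 3) (by simpa using hε.ne')] with n hn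
  have hmeas : ∀ (k : Ω → ℝ) (m : MeasurableSpace Ω), AEStronglyMeasurable[mΩ] P[k | m] P :=
    fun k m => integrable_condExp.aestronglyMeasurable
  have h12 : eLpNorm (P[g | 𝓑 n] - P[g | ⨅ n, 𝓑 n]) 1 P ≤ ε / 3 :=
    (eLpNorm_le_eLpNorm_of_exponent_le one_le_two ((hmeas _ _).sub (hmeas _ _))).trans hn
  have hdec : P[f | 𝓑 n] - P[f | ⨅ n, 𝓑 n] = (P[f | 𝓑 n] - P[g | 𝓑 n]) +
      ((P[g | 𝓑 n] - P[g | ⨅ n, 𝓑 n]) - (P[f | ⨅ n, 𝓑 n] - P[g | ⨅ n, 𝓑 n])) := by abel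
  rw [hdec]
  refine (eLpNorm_add_le ((hmeas _ _).sub (hmeas _ _))
    (((hmeas _ _).sub (hmeas _ _)).sub ((hmeas _ _).sub (hmeas _ _))) le_rfl).trans ?_
  refine (add_le_add le_rfl (eLpNorm_sub_le ((hmeas _ _).sub (hmeas _ _))
    ((hmeas _ _).sub (hmeas _ _)) le_rfl)).trans ?_
  refine (add_le_add (hsub _) (add_le_add h12 (hsub _))).trans_eq ?_
  rw [← add_assoc, ENNReal.add_thirds]

/-- Doob's maximal inequality for a decreasing sequence of `σ`-algebras. -/
theorem measure_exists_le_condExp_of_antitone [IsFiniteMeasure P] (h𝓑 : ∀ n, 𝓑 n ≤ mΩ)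
    (hanti : Antitone 𝓑) {f : Ω → ℝ} (hf0 : 0 ≤ f) (ε : NNReal) :
    ε * P {ω | ∃ n, (ε : ℝ) ≤ P[f | 𝓑 n] ω} ≤ ENNReal.ofReal (∫ ω, f ω ∂P) := by
  have key : ∀ N : ℕ, ε * P {ω | ∃ n ≤ N, (ε : ℝ) ≤ P[f | 𝓑 n] ω} ≤
      ENNReal.ofReal (∫ ω, f ω ∂P) := by
    intro N
    -- Reversing time up to `N` gives an increasing filtration ending in `𝓑 0`. The positive part
    -- makes the submartingale nonnegative everywhere, as the maximal inequality demands.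
    let 𝒢 : Filtration ℕ mΩ :=
      { seq := fun k => 𝓑 (N - k)
        mono' := fun i j hij => hanti (Nat.sub_le_sub_left hij N)
        le' := fun k => h𝓑 _ }
    have hsub : Submartingale (fun k => P[f | 𝒢 k])⁺ 𝒢 P :=
      (martingale_condExp f 𝒢 P).submartingale.pos
    have hmax := maximal_ineq hsub (fun k ω => by simp) (ε := ε) N
    have hsubset : {ω | ∃ n ≤ N, (ε : ℝ) ≤ P[f | 𝓑 n] ω} ⊆ {ω | (ε : ℝ) ≤
        (Finset.range (N + 1)).sup' Finset.nonempty_range_add_one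
          fun k => (fun k => P[f | 𝒢 k])⁺ k ω} := by
      rintro ω ⟨n, hnN, hn⟩
      rw [Set.mem_ofPred_eq, Finset.le_sup'_iff]
      refine ⟨N - n, by simp, hn.trans ?_⟩
      have : 𝒢 (N - n) = 𝓑 n := by
        change 𝓑 (N - (N - n)) = 𝓑 n
        rw [Nat.sub_sub_self hnN]
      simp only [this, Pi.posPart_apply]
      exact le_posPart _
    refine ((mul_le_mul_right (measure_mono hsubset) _).trans hmax).trans
      (ENNReal.ofReal_le_ofReal ?_)
    refine (setIntegral_le_integral (hsub.integrable N)
      (ae_of_all _ fun ω => by simp)).trans_eq ?_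
    rw [← integral_condExp (f := f) (h𝓑 0)]
    refine integral_congr_ae ?_
    filter_upwards [condExp_nonneg (m := 𝓑 0) (ae_of_all P hf0)] with ω hω
    have : 𝒢 N = 𝓑 0 := by
      change 𝓑 (N - N) = 𝓑 0
      rw [Nat.sub_self]
    simp only [Pi.posPart_apply, this]
    exact posPart_of_nonneg hω
  have hU : {ω | ∃ n, (ε : ℝ) ≤ P[f | 𝓑 n] ω} =
      ⋃ N, {ω | ∃ n ≤ N, (ε : ℝ) ≤ P[f | 𝓑 n] ω} := by
    ext ω
    simp only [Set.mem_ofPred_eq, Set.mem_iUnion]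
    exact ⟨fun ⟨n, h⟩ => ⟨n, n, le_rfl, h⟩, fun ⟨_, n, _, h⟩ => ⟨n, h⟩⟩
  have hm : Monotone fun N : ℕ => {ω | ∃ n ≤ N, (ε : ℝ) ≤ P[f | 𝓑 n] ω} :=
    fun i j hij ω ⟨n, hn, h⟩ => ⟨n, hn.trans hij, h⟩
  rw [hU]
  exact le_of_tendsto (ENNReal.Tendsto.const_mul (tendsto_measure_iUnion_atTop hm)
    (Or.inr ENNReal.coe_ne_top)) (Eventually.of_forall key)

/-- **Lévy's downward theorem**, almost everywhere version. -/
theorem tendsto_ae_condExp_iInf [IsProbabilityMeasure P] (h𝓑 : ∀ n, 𝓑 n ≤ mΩ)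
    (hanti : Antitone 𝓑) {f : Ω → ℝ} (hf : Integrable f P) :
    ∀ᵐ ω ∂P, Tendsto (fun n => P[f | 𝓑 n] ω) atTop (𝓝 (P[f | ⨅ n, 𝓑 n] ω)) := by
  have hinf : (⨅ n, 𝓑 n) ≤ mΩ := (iInf_le 𝓑 0).trans (h𝓑 0)
  set g := P[f | ⨅ n, 𝓑 n] with hg
  have hgi : Integrable g P := integrable_condExp
  -- Tower property: `g` is measurable for every `𝓑 (m + k)`, so the left side is the conditional
  -- expectation of `P[f | 𝓑 m] - g`.
  have hdom : ∀ᵐ ω ∂P, ∀ m k : ℕ, |P[f | 𝓑 (m + k)] ω - g ω| ≤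
      P[fun ω => |P[f | 𝓑 m] ω - g ω| | 𝓑 (m + k)] ω := by
    refine ae_all_iff.2 fun m => ae_all_iff.2 fun k => ?_
    have hu : Integrable (P[f | 𝓑 m] - g) P := integrable_condExp.sub hgi
    have h1 : P[P[f | 𝓑 m] - g | 𝓑 (m + k)] =ᵐ[P] P[f | 𝓑 (m + k)] - g := by
      refine (condExp_sub integrable_condExp hgi _).trans ?_
      refine (condExp_condExp_of_le (hanti (Nat.le_add_right m k)) (h𝓑 m)).sub ?_
      rw [condExp_of_stronglyMeasurable (h𝓑 _)
        (stronglyMeasurable_condExp.mono (iInf_le 𝓑 _)) hgi]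
    have h2 : P[P[f | 𝓑 m] - g | 𝓑 (m + k)] ≤ᵐ[P]
        P[fun ω => |P[f | 𝓑 m] ω - g ω| | 𝓑 (m + k)] :=
      condExp_mono hu hu.abs (ae_of_all _ fun ω => le_abs_self _)
    have h3 : P[-(P[f | 𝓑 m] - g) | 𝓑 (m + k)] ≤ᵐ[P]
        P[fun ω => |P[f | 𝓑 m] ω - g ω| | 𝓑 (m + k)] :=
      condExp_mono hu.neg hu.abs (ae_of_all _ fun ω => neg_le_abs _)
    filter_upwards [h1, h2, h3, condExp_neg (P[f | 𝓑 m] - g) (𝓑 (m + k))] with ω h1 h2 h3 h4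
    rw [h1] at h2
    rw [h4, Pi.neg_apply, h1] at h3
    exact abs_le'.2 ⟨h2, h3⟩
  have hbad : ∀ ε : NNReal, 0 < ε → P {ω | ∃ᶠ n in atTop, (ε : ℝ) ≤ |P[f | 𝓑 n] ω - g ω|} = 0 := by
    intro ε hε
    -- The maximal inequality for the sequence started at `m` bounds the bad set by an `L¹` distance
    -- that tends to zero in `m`.
    have hle : ∀ m, ε * P {ω | ∃ᶠ n in atTop, (ε : ℝ) ≤ |P[f | 𝓑 n] ω - g ω|} ≤
        eLpNorm (P[f | 𝓑 m] - g) 1 P := by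
      intro m
      have hmax := measure_exists_le_condExp_of_antitone (P := P)
        (𝓑 := fun k => 𝓑 (m + k)) (fun k => h𝓑 _) (fun i j hij => hanti (by omega))
        (f := fun ω => |P[f | 𝓑 m] ω - g ω|) (fun ω => abs_nonneg _) ε
      have hint : ENNReal.ofReal (∫ ω, |P[f | 𝓑 m] ω - g ω| ∂P) =
          eLpNorm (P[f | 𝓑 m] - g) 1 P := by
        rw [eLpNorm_one_eq_lintegral_enorm, ← ofReal_integral_norm_eq_lintegral_enorm
          (integrable_condExp.sub hgi)]
        rfl
      rw [hint] at hmax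
      refine (mul_le_mul_right (measure_mono_ae ?_) _).trans hmax
      filter_upwards [hdom] with ω hω hfreq
      obtain ⟨n, hmn, hn⟩ := (frequently_atTop.1 hfreq) m
      obtain ⟨k, rfl⟩ := Nat.exists_eq_add_of_le hmn
      exact ⟨k, hn.trans (hω m k)⟩
    have h0 : ε * P {ω | ∃ᶠ n in atTop, (ε : ℝ) ≤ |P[f | 𝓑 n] ω - g ω|} ≤ 0 :=
      ge_of_tendsto' (tendsto_eLpNorm_one_condExp_iInf h𝓑 hanti hf) hle
    simpa [hε.ne'] using h0
  have hall : ∀ᵐ ω ∂P, ∀ k : ℕ, ¬ ∃ᶠ n in atTop,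
      (((k + 1 : NNReal)⁻¹ : NNReal) : ℝ) ≤ |P[f | 𝓑 n] ω - g ω| :=
    ae_all_iff.2 fun k => by
      rw [ae_iff]
      simpa only [not_not] using hbad ((k + 1 : NNReal)⁻¹) (by positivity)
  filter_upwards [hall] with ω hω
  rw [Metric.tendsto_nhds]
  intro δ hδ
  obtain ⟨k, hk⟩ := exists_nat_one_div_lt hδ
  filter_upwards [not_frequently.1 (hω k)] with n hn
  rw [Real.dist_eq]
  refine (not_le.1 hn).trans ?_
  simpa using hk

end ReverseMartingale

/-! ### Integrals against disintegrations as conditional expectations. -/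

section Disintegration

variable {Ω : Type*} {𝓑 : MeasurableSpace Ω} {mΩ : MeasurableSpace Ω} {P : Measure Ω}
  {Q : Ω → Measure Ω}

theorem IsDisintegration.measurable_kernel (hQ : IsDisintegration 𝓑 P Q) : Measurable[𝓑] Q :=
  Measure.measurable_of_measurable_coe Q hQ.measurable

theorem IsDisintegration.measurable_lintegral (hQ : IsDisintegration 𝓑 P Q) {h : Ω → ℝ≥0∞}
    (hh : Measurable h) : Measurable[𝓑] fun ω => ∫⁻ x, h x ∂Q ω :=
  (Measure.measurable_lintegral hh).comp hQ.measurable_kernel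

/-- The defining identity of conditional expectation on sets, phrased as an equality of measures so
that it passes to all nonnegative measurable functions. -/
theorem IsDisintegration.bind_restrict [IsFiniteMeasure P] (h𝓑 : 𝓑 ≤ mΩ)
    (hQ : IsDisintegration 𝓑 P Q) {B : Set Ω} (hB : MeasurableSet[𝓑] B) :
    (P.restrict B).bind Q = P.restrict B := by
  have := hQ.isProbabilityMeasure
  have hQm : Measurable Q := hQ.measurable_kernel.mono h𝓑 le_rfl
  ext A hA
  rw [Measure.bind_apply hA hQm.aemeasurable, Measure.restrict_apply hA]
  have hi : Integrable (fun ω => (Q ω).real A) (P.restrict B) := by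
    refine Integrable.of_bound (C := 1) ?_ (ae_of_all _ fun ω => ?_)
    · exact ((Measure.measurable_coe hA).comp hQm).ennreal_toReal.aestronglyMeasurable
    · simp [abs_of_nonneg, measureReal_le_one]
  calc ∫⁻ ω, Q ω A ∂P.restrict B = ∫⁻ ω, ENNReal.ofReal ((Q ω).real A) ∂P.restrict B := by
        simp
    _ = ENNReal.ofReal (∫ ω in B, (Q ω).real A ∂P) :=
        (ofReal_integral_eq_lintegral_ofReal hi (ae_of_all _ fun ω => measureReal_nonneg)).symm
    _ = ENNReal.ofReal (∫ ω in B, A.indicator (fun _ => (1 : ℝ)) ω ∂P) := by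
        rw [← setIntegral_condExp h𝓑 ((integrable_const (1 : ℝ)).indicator hA) hB]
        congr 1
        exact integral_congr_ae (ae_restrict_of_ae (hQ.ae_eq_condExp A hA))
    _ = P (A ∩ B) := by
        rw [integral_indicator_const _ hA]
        simp [measureReal_restrict_apply hA]

theorem IsDisintegration.setLIntegral_lintegral [IsFiniteMeasure P] (h𝓑 : 𝓑 ≤ mΩ)
    (hQ : IsDisintegration 𝓑 P Q) {B : Set Ω} (hB : MeasurableSet[𝓑] B) {h : Ω → ℝ≥0∞}
    (hh : Measurable h) : ∫⁻ ω in B, ∫⁻ x, h x ∂Q ω ∂P = ∫⁻ ω in B, h ω ∂P := by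
  rw [← Measure.lintegral_bind (hQ.measurable_kernel.mono h𝓑 le_rfl).aemeasurable
    hh.aemeasurable, hQ.bind_restrict h𝓑 hB]

theorem IsDisintegration.lintegral_lintegral [IsFiniteMeasure P] (h𝓑 : 𝓑 ≤ mΩ)
    (hQ : IsDisintegration 𝓑 P Q) {h : Ω → ℝ≥0∞} (hh : Measurable h) :
    ∫⁻ ω, ∫⁻ x, h x ∂Q ω ∂P = ∫⁻ ω, h ω ∂P := by
  simpa using hQ.setLIntegral_lintegral h𝓑 MeasurableSet.univ hh

theorem IsDisintegration.ae_lintegral_lt_top [IsFiniteMeasure P] (h𝓑 : 𝓑 ≤ mΩ)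
    (hQ : IsDisintegration 𝓑 P Q) {h : Ω → ℝ≥0∞} (hh : Measurable h) (hfin : ∫⁻ ω, h ω ∂P ≠ ∞) :
    ∀ᵐ ω ∂P, ∫⁻ x, h x ∂Q ω < ∞ :=
  ae_lt_top ((hQ.measurable_lintegral hh).mono h𝓑 le_rfl)
    (by rwa [hQ.lintegral_lintegral h𝓑 hh])

theorem IsDisintegration.toReal_lintegral_ae_eq_condExp [IsFiniteMeasure P] (h𝓑 : 𝓑 ≤ mΩ)
    (hQ : IsDisintegration 𝓑 P Q) {h : Ω → ℝ≥0∞} (hh : Measurable h) (hfin : ∫⁻ ω, h ω ∂P ≠ ∞) :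
    (fun ω => (∫⁻ x, h x ∂Q ω).toReal) =ᵐ[P] P[fun ω => (h ω).toReal | 𝓑] := by
  have hmeas := hQ.measurable_lintegral hh
  have hmeas' : Measurable fun ω => ∫⁻ x, h x ∂Q ω := hmeas.mono h𝓑 le_rfl
  have hfin' : ∫⁻ ω, ∫⁻ x, h x ∂Q ω ∂P ≠ ∞ := by rwa [hQ.lintegral_lintegral h𝓑 hh]
  refine ae_eq_condExp_of_forall_setIntegral_eq h𝓑 (integrable_toReal_of_lintegral_ne_top
    hh.aemeasurable hfin) (fun B _ _ => (integrable_toReal_of_lintegral_ne_top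
    hmeas'.aemeasurable hfin').integrableOn) (fun B hB _ => ?_)
    (hmeas.ennreal_toReal.aestronglyMeasurable)
  rw [integral_toReal hmeas'.aemeasurable (ae_restrict_of_ae (ae_lt_top hmeas' hfin')),
    integral_toReal hh.aemeasurable (ae_restrict_of_ae (ae_lt_top hh hfin)),
    hQ.setLIntegral_lintegral h𝓑 hB hh]

/-- Almost sure convergence of the integrals against the disintegrations along a monotone or
antitone sequence of `σ`-algebras. -/
theorem ae_tendsto_lintegral_disintegration [IsProbabilityMeasure P]
    {𝓑 : ℕ∞ → MeasurableSpace Ω} (h𝓑 : ∀ n, 𝓑 n ≤ mΩ)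
    (hlim : (Monotone (fun n : ℕ => 𝓑 n) ∧ 𝓑 ⊤ = ⨆ n : ℕ, 𝓑 n) ∨
      (Antitone (fun n : ℕ => 𝓑 n) ∧ 𝓑 ⊤ = ⨅ n : ℕ, 𝓑 n))
    {Q : ℕ∞ → Ω → Measure Ω} (hQ : ∀ n, IsDisintegration (𝓑 n) P (Q n))
    {h : Ω → ℝ≥0∞} (hh : Measurable h) (hfin : ∫⁻ ω, h ω ∂P ≠ ∞) :
    ∀ᵐ ω ∂P, Tendsto (fun n : ℕ => ∫⁻ x, h x ∂Q n ω) atTop (𝓝 (∫⁻ x, h x ∂Q ⊤ ω)) := by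
  have hce : ∀ᵐ ω ∂P, Tendsto (fun n : ℕ => P[fun ω => (h ω).toReal | 𝓑 n] ω) atTop
      (𝓝 (P[fun ω => (h ω).toReal | 𝓑 ⊤] ω)) := by
    rcases hlim with ⟨hm, htop⟩ | ⟨hm, htop⟩
    · rw [htop]
      exact tendsto_ae_condExp (ℱ := ⟨fun n : ℕ => 𝓑 n, hm, fun n => h𝓑 n⟩) _
    · rw [htop]
      exact tendsto_ae_condExp_iInf (fun n : ℕ => h𝓑 n) hm
        (integrable_toReal_of_lintegral_ne_top hh.aemeasurable hfin)
  have h1 : ∀ᵐ ω ∂P, ∀ n : ℕ, (∫⁻ x, h x ∂Q n ω).toReal = P[fun ω => (h ω).toReal | 𝓑 n] ω :=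
    ae_all_iff.2 fun n => (hQ n).toReal_lintegral_ae_eq_condExp (h𝓑 n) hh hfin
  have h2 : ∀ᵐ ω ∂P, ∀ n : ℕ, ∫⁻ x, h x ∂Q n ω < ∞ :=
    ae_all_iff.2 fun n => (hQ n).ae_lintegral_lt_top (h𝓑 n) hh hfin
  filter_upwards [hce, h1, h2, (hQ ⊤).toReal_lintegral_ae_eq_condExp (h𝓑 ⊤) hh hfin,
    (hQ ⊤).ae_lintegral_lt_top (h𝓑 ⊤) hh hfin] with ω hce h1 h2 h3 h4
  rw [← ENNReal.tendsto_toReal_iff (fun n => (h2 n).ne) h4.ne]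
  simp only [h1]
  rwa [h3]

end Disintegration

/-! ### Couplings of image measures and the basic contraction estimate. -/

section Wasserstein

variable {Ω M : Type*} [MetricSpace M] [MeasurableSpace M] [BorelSpace M]

/-- The range of `f` is separable, so its part outside the support is Lindelöf and is covered by
countably many null sets. -/
theorem isFullySupported_map {X : Type*} {mΩ : MeasurableSpace Ω} [TopologicalSpace X]
    [TopologicalSpace.PseudoMetrizableSpace X]
    [MeasurableSpace X] [BorelSpace X] (μ : Measure Ω) [IsProbabilityMeasure μ] {f : Ω → X}
    (hf : StronglyMeasurable f) : IsFullySupported (μ.map f) where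
  isProbabilityMeasure := Measure.isProbabilityMeasure_map hf.measurable.aemeasurable
  measure_compl_support := by
    let S := (μ.map f).supportᶜ ∩ Set.range f
    have hS : IsLindelof S := by
      let := TopologicalSpace.pseudoMetrizableSpacePseudoMetric X
      have hsep : TopologicalSpace.IsSeparable S :=
        hf.isSeparable_range.mono Set.inter_subset_right
      have := hsep.secondCountableTopology
      exact IsLindelof.of_coe
    have h0 : Sᶜ ∈ ae (μ.map f) := by
      refine hS.compl_mem_sets_of_nhdsWithin fun x hx => ?_
      obtain ⟨U, hU, hU0⟩ := Measure.notMem_support_iff_exists.1 hx.1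
      exact ⟨U, mem_nhdsWithin_of_mem_nhds hU, by rwa [compl_mem_ae_iff]⟩
    have hS0 : μ.map f S = 0 := by simpa [mem_ae_iff] using h0
    -- `S` need not be measurable, so its preimage is bounded by `Measure.le_map_apply`.
    rw [Measure.map_apply hf.measurable Measure.isOpen_compl_support.measurableSet]
    refine measure_mono_null ?_
      (nonpos_iff_eq_zero.1 ((Measure.le_map_apply hf.measurable.aemeasurable S).trans hS0.le))
    exact fun ω hω => ⟨hω, Set.mem_range_self ω⟩

theorem map_mem_PMeasures {mΩ : MeasurableSpace Ω} {p : ℝ} (μ : Measure Ω)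
    [IsProbabilityMeasure μ] {f : Ω → M}
    (hf : StronglyMeasurable f) {x : M} (hfin : ∫⁻ ω, edist x (f ω) ^ p ∂μ < ∞) :
    μ.map f ∈ PMeasures M p := by
  refine ⟨isFullySupported_map μ hf, x, ?_⟩
  rwa [lintegral_map (by fun_prop) hf.measurable]

theorem wasserstein_map_le {mΩ : MeasurableSpace Ω} {p : ℝ} (hp : 1 ≤ p) (μ : Measure Ω)
    [IsProbabilityMeasure μ] {f g : Ω → M} (hf : StronglyMeasurable f)
    (hg : StronglyMeasurable g) :
    wasserstein p (μ.map f) (μ.map g) ^ p ≤ ∫⁻ ω, edist (f ω) (g ω) ^ p ∂μ := by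
  let : MeasurableSpace (M × M) := borel (M × M)
  have : BorelSpace (M × M) := ⟨rfl⟩
  -- Strong measurability gives measurability for the full Borel σ-algebra of `M × M`, even if `M`
  -- is not separable.
  have hfg : StronglyMeasurable fun ω => (f ω, g ω) := hf.prodMk hg
  have hfst : Measurable (Prod.fst : M × M → M) := continuous_fst.measurable
  have hsnd : Measurable (Prod.snd : M × M → M) := continuous_snd.measurable
  have hmem : μ.map (fun ω => (f ω, g ω)) ∈ couplings (μ.map f) (μ.map g) := by
    refine ⟨isFullySupported_map μ hfg, fun B hB => ⟨?_, ?_⟩⟩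
    · rw [Set.prod_univ, Measure.map_apply hfg.measurable (hfst hB),
        Measure.map_apply hf.measurable hB]
      rfl
    · rw [Set.univ_prod, Measure.map_apply hfg.measurable (hsnd hB),
        Measure.map_apply hg.measurable hB]
      rfl
  have hp0 : p ≠ 0 := by linarith
  have hcost : Measurable fun z : M × M => edist z.1 z.2 ^ p :=
    (continuous_edist (α := M)).measurable.pow_const p
  rw [wasserstein, ← ENNReal.rpow_mul, one_div, inv_mul_cancel₀ hp0, ENNReal.rpow_one]
  refine (iInf₂_le _ hmem).trans_eq ?_
  rw [lintegral_map hcost hfg.measurable]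

variable {p : ℝ} {β : Measure M → M}

theorem IsContractiveBarycentricMap.edist_rpow_le {mΩ : MeasurableSpace Ω}
    (hβ : IsContractiveBarycentricMap p β)
    (hp : 1 ≤ p) (μ : Measure Ω) [IsProbabilityMeasure μ] {f g : Ω → M}
    (hf : StronglyMeasurable f) (hg : StronglyMeasurable g) {x y : M}
    (hfx : ∫⁻ ω, edist x (f ω) ^ p ∂μ < ∞) (hgy : ∫⁻ ω, edist y (g ω) ^ p ∂μ < ∞) :
    edist (β (μ.map f)) (β (μ.map g)) ^ p ≤ ∫⁻ ω, edist (f ω) (g ω) ^ p ∂μ :=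
  (ENNReal.rpow_le_rpow (hβ.contractive _ (map_mem_PMeasures μ hf hfx) _
    (map_mem_PMeasures μ hg hgy)) (by linarith)).trans (wasserstein_map_le hp μ hf hg)

/-- Comparison with the constant function `x`, whose law is a Dirac mass. -/
theorem IsContractiveBarycentricMap.edist_const_rpow_le {mΩ : MeasurableSpace Ω}
    (hβ : IsContractiveBarycentricMap p β)
    (hp : 1 ≤ p) (μ : Measure Ω) [IsProbabilityMeasure μ] {f : Ω → M}
    (hf : StronglyMeasurable f) {x : M} (hfx : ∫⁻ ω, edist x (f ω) ^ p ∂μ < ∞) :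
    edist x (β (μ.map f)) ^ p ≤ ∫⁻ ω, edist x (f ω) ^ p ∂μ := by
  have h := hβ.edist_rpow_le hp μ (stronglyMeasurable_const (b := x)) hf (x := x) (y := x)
    (by simp [ENNReal.zero_rpow_of_pos (zero_lt_one.trans_le hp)]) hfx
  rwa [Measure.map_const, measure_univ, one_smul, hβ.map_dirac] at h

end Wasserstein

/-! ### Continuity of the barycenter in the weights of fixed atoms. -/

section FinitelySupported

variable {ι M : Type*} [Fintype ι] {p : ℝ}

/-- The measure `∑ i, a i • δ_{x i}`. -/
noncomputable def atomicMeasure [MeasurableSpace M] (a : ι → ℝ) (x : ι → M) : Measure M :=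
  ∑ i, ENNReal.ofReal (a i) • Measure.dirac (x i)

theorem map_sum_dirac [MeasurableSpace M] {J : Type*} [Fintype J] [MeasurableSpace J] [DiscreteMeasurableSpace J]
    (c : J → ℝ≥0∞) (f : J → M) :
    (∑ z, c z • Measure.dirac z).map f = ∑ z, c z • Measure.dirac (f z) := by
  ext A hA
  rw [Measure.map_apply .of_discrete hA]
  simp [Measure.finsetSum_apply, Measure.dirac_apply' _ hA, Set.indicator]
  rfl

/-- Two points of the simplex have a coupling whose off-diagonal part has mass at most
the `ℓ¹`-distance. -/
theorem exists_coupling_stdSimplex {a b : ι → ℝ} (ha : a ∈ stdSimplex ℝ ι)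
    (hb : b ∈ stdSimplex ℝ ι) : ∃ π ρ : ι → ι → ℝ, (∀ i j, 0 ≤ π i j) ∧ (∀ i j, 0 ≤ ρ i j) ∧
      (∀ i, ∑ j, π i j = a i) ∧ (∀ j, ∑ i, π i j = b j) ∧ (∀ i j, i ≠ j → π i j = ρ i j) ∧
      ∑ i, ∑ j, ρ i j ≤ ∑ i, |a i - b i| := by
  classical
  set c : ι → ℝ := fun i => min (a i) (b i) with hc
  set r : ℝ := 1 - ∑ i, c i with hr
  have hac : ∀ i, 0 ≤ a i - c i := fun i => sub_nonneg.2 (min_le_left _ _)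
  have hbc : ∀ i, 0 ≤ b i - c i := fun i => sub_nonneg.2 (min_le_right _ _)
  have hsa : ∑ i, (a i - c i) = r := by rw [Finset.sum_sub_distrib, ha.2]
  have hsb : ∑ i, (b i - c i) = r := by rw [Finset.sum_sub_distrib, hb.2]
  have hr0 : 0 ≤ r := hsa ▸ Finset.sum_nonneg fun i _ => hac i
  have hc0 : ∀ i, 0 ≤ c i := fun i => le_min (ha.1 i) (hb.1 i)
  -- If `r = 0`, division returns zero, which is right because then `d = 0`.
  have hz : ∀ d : ι → ℝ, (∀ i, 0 ≤ d i) → ∑ i, d i = r → ∀ i, d i * r / r = d i := by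
    intro d hd hs i
    rcases eq_or_ne r 0 with h | h
    · have : d i = 0 :=
        (Finset.sum_eq_zero_iff_of_nonneg fun i _ => hd i).1 (hs.trans h) i (Finset.mem_univ i)
      simp [this]
    · field_simp
  have hρ : ∀ i j, 0 ≤ (a i - c i) * (b j - c j) / r := fun i j =>
    div_nonneg (mul_nonneg (hac i) (hbc j)) hr0
  -- The common mass `c` stays on the diagonal; the excesses, each of total mass `r`, are coupled by
  -- their normalized product `ρ`.
  refine ⟨fun i j => (if i = j then c i else 0) + (a i - c i) * (b j - c j) / r,
    fun i j => (a i - c i) * (b j - c j) / r, fun i j => ?_, hρ, fun i => ?_, fun j => ?_,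
    fun i j hij => ?_, ?_⟩
  · refine add_nonneg ?_ (hρ i j)
    split_ifs
    exacts [hc0 i, le_rfl]
  · rw [Finset.sum_add_distrib, Finset.sum_ite_eq, if_pos (Finset.mem_univ i), ← Finset.sum_div,
      ← Finset.mul_sum, hsb, hz _ hac hsa]
    ring
  · rw [Finset.sum_add_distrib, Finset.sum_ite_eq', if_pos (Finset.mem_univ j), ← Finset.sum_div,
      ← Finset.sum_mul, hsa, mul_comm, hz _ hbc hsb]
    ring
  · simp [hij]
  · calc ∑ i, ∑ j, (a i - c i) * (b j - c j) / r = ∑ i, (a i - c i) := by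
          refine Finset.sum_congr rfl fun i _ => ?_
          rw [← Finset.sum_div, ← Finset.mul_sum, hsb, hz _ hac hsa]
      _ ≤ ∑ i, |a i - b i| := by
          refine Finset.sum_le_sum fun i _ => ?_
          rcases min_cases (a i) (b i) with ⟨h, -⟩ | ⟨h, -⟩
          · simp [hc, h]
          · simpa [hc, h] using le_abs_self (a i - b i)

theorem sum_edist_rpow_ne_top [MetricSpace M] (hp : 1 ≤ p) (x : ι → M) :
    ∑ i, ∑ j, edist (x i) (x j) ^ p ≠ ∞ :=
  (ENNReal.sum_lt_top.2 fun _ _ => ENNReal.sum_lt_top.2 fun _ _ =>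
    ENNReal.rpow_lt_top_of_nonneg (by linarith) (edist_ne_top _ _)).ne

/-- An extended nonnegative function tends to zero as soon as a positive power does. -/
theorem tendsto_zero_of_rpow {α : Type*} {l : Filter α} {u : α → ℝ≥0∞} (hp : 1 ≤ p)
    (h : Tendsto (fun t => u t ^ p) l (𝓝 0)) : Tendsto u l (𝓝 0) := by
  have hp0 : 0 < p := by linarith
  have h2 := ((ENNReal.continuous_rpow_const (y := 1 / p)).tendsto 0).comp h
  rw [ENNReal.zero_rpow_of_pos (by positivity)] at h2
  refine h2.congr fun t => ?_
  simp [← ENNReal.rpow_mul, hp0.ne']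

variable [MetricSpace M] [MeasurableSpace M] [BorelSpace M] {β : Measure M → M}

/-- The diagonal of the coupling costs nothing, and every other cost is at most the double sum. -/
theorem IsContractiveBarycentricMap.edist_atomicMeasure_rpow_le
    (hβ : IsContractiveBarycentricMap p β) (hp : 1 ≤ p) {a b : ι → ℝ}
    (ha : a ∈ stdSimplex ℝ ι) (hb : b ∈ stdSimplex ℝ ι) (x : ι → M) :
    edist (β (atomicMeasure a x)) (β (atomicMeasure b x)) ^ p ≤
      ENNReal.ofReal (∑ i, |a i - b i|) * ∑ i, ∑ j, edist (x i) (x j) ^ p := by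
  obtain ⟨π, ρ, hπ, hρ, hπa, hπb, hπρ, hρle⟩ := exists_coupling_stdSimplex ha hb
  have hp0 : 0 < p := by linarith
  let : MeasurableSpace (ι × ι) := ⊤
  have : DiscreteMeasurableSpace (ι × ι) := ⟨fun _ => trivial⟩
  let μ : Measure (ι × ι) := ∑ z, ENNReal.ofReal (π z.1 z.2) • Measure.dirac z
  have hlint : ∀ h : ι × ι → ℝ≥0∞,
      ∫⁻ z, h z ∂μ = ∑ i, ∑ j, ENNReal.ofReal (π i j) * h (i, j) := fun h => by
    simp [μ, Fintype.sum_prod_type]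
  have hμ : IsProbabilityMeasure μ := by
    refine ⟨?_⟩
    have h1 := hlint 1
    simp only [Pi.one_apply, lintegral_one, mul_one] at h1
    rw [h1]
    simp_rw [← ENNReal.ofReal_sum_of_nonneg fun j _ => hπ _ j, hπa]
    rw [← ENNReal.ofReal_sum_of_nonneg fun i _ => ha.1 i, ha.2, ENNReal.ofReal_one]
  have hmapa : μ.map (fun z => x z.1) = atomicMeasure a x := by
    rw [map_sum_dirac, Fintype.sum_prod_type, atomicMeasure]
    refine Finset.sum_congr rfl fun i _ => ?_
    dsimp only
    rw [← Finset.sum_smul, ← ENNReal.ofReal_sum_of_nonneg fun j _ => hπ _ j, hπa]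
  have hmapb : μ.map (fun z => x z.2) = atomicMeasure b x := by
    rw [map_sum_dirac, Fintype.sum_prod_type_right, atomicMeasure]
    refine Finset.sum_congr rfl fun j _ => ?_
    dsimp only
    rw [← Finset.sum_smul, ← ENNReal.ofReal_sum_of_nonneg fun i _ => hπ i _, hπb]
  have hfin : ∀ (f : ι × ι → M) (y : M), ∫⁻ z, edist y (f z) ^ p ∂μ < ∞ := fun f y => by
    rw [hlint]
    exact ENNReal.sum_lt_top.2 fun i _ => ENNReal.sum_lt_top.2 fun j _ =>
      ENNReal.mul_lt_top ENNReal.ofReal_lt_top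
        (ENNReal.rpow_lt_top_of_nonneg hp0.le (edist_ne_top _ _))
  -- Any point of `M` serves; this only shows that one exists.
  have y : M := β (μ.map fun z => x z.1)
  have hmain := hβ.edist_rpow_le hp μ (f := fun z => x z.1) (g := fun z => x z.2)
    .of_discrete .of_discrete (hfin _ y) (hfin _ y)
  rw [hmapa, hmapb, hlint] at hmain
  refine hmain.trans ?_
  set D := ∑ i, ∑ j, edist (x i) (x j) ^ p
  have hD : ∀ i j, edist (x i) (x j) ^ p ≤ D := fun i j =>
    (Finset.single_le_sum (f := fun j => edist (x i) (x j) ^ p) (fun _ _ => zero_le)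
      (Finset.mem_univ j)).trans
    (Finset.single_le_sum (f := fun i => ∑ j, edist (x i) (x j) ^ p) (fun _ _ => zero_le)
      (Finset.mem_univ i))
  calc ∑ i, ∑ j, ENNReal.ofReal (π i j) * edist (x i) (x j) ^ p
      ≤ ∑ i, ∑ j, ENNReal.ofReal (ρ i j) * D := by
        refine Finset.sum_le_sum fun i _ => Finset.sum_le_sum fun j _ => ?_
        rcases eq_or_ne i j with rfl | hij
        · simp [ENNReal.zero_rpow_of_pos hp0]
        · rw [hπρ i j hij]
          gcongr
          exact hD i j
    _ = ENNReal.ofReal (∑ i, ∑ j, ρ i j) * D := by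
        simp_rw [← Finset.sum_mul]
        rw [ENNReal.ofReal_sum_of_nonneg fun i _ => Finset.sum_nonneg fun j _ => hρ i j]
        simp_rw [ENNReal.ofReal_sum_of_nonneg fun j _ => hρ _ j]
    _ ≤ _ := by gcongr

theorem IsContractiveBarycentricMap.continuous_atomicMeasure
    (hβ : IsContractiveBarycentricMap p β) (hp : 1 ≤ p) (x : ι → M) :
    Continuous fun a : stdSimplex ℝ ι => β (atomicMeasure (a : ι → ℝ) x) := by
  rw [continuous_iff_continuousAt]
  intro b
  rw [ContinuousAt, tendsto_iff_edist_tendsto_0]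
  refine tendsto_zero_of_rpow hp (tendsto_of_tendsto_of_tendsto_of_le_of_le tendsto_const_nhds ?_
    (fun _ => zero_le) fun a => hβ.edist_atomicMeasure_rpow_le hp a.2 b.2 x)
  have hcont : Continuous fun a : stdSimplex ℝ ι => ∑ i, |(a : ι → ℝ) i - (b : ι → ℝ) i| := by
    refine continuous_finsetSum _ fun i _ => ?_
    exact (((continuous_apply i).comp continuous_subtype_val).sub continuous_const).abs
  have h := ENNReal.Tendsto.mul_const
    (ENNReal.tendsto_ofReal (hcont.tendsto b)) (Or.inr (sum_edist_rpow_ne_top hp x))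
  have h0 : ENNReal.ofReal (∑ i, |(b : ι → ℝ) i - (b : ι → ℝ) i|) *
      ∑ i, ∑ j, edist (x i) (x j) ^ p = 0 := by simp
  rw [h0] at h
  exact h

end FinitelySupported

/-! ### Simple functions: laws, measurability and approximation. -/

section SimpleFunctions

variable {Ω M : Type*} {𝓑 mΩ : MeasurableSpace Ω} {p : ℝ}

theorem map_simpleFunc [MeasurableSpace M] (μ : Measure Ω) [IsProbabilityMeasure μ] (s : SimpleFunc Ω M) :
    μ.map s = atomicMeasure (fun y : s.range => μ.real (s ⁻¹' {(y : M)})) Subtype.val := by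
  classical
  ext A hA
  rw [Measure.map_apply s.measurable hA, atomicMeasure, Measure.finsetSum_apply]
  simp only [Measure.smul_apply, Measure.dirac_apply' _ hA, smul_eq_mul]
  rw [Finset.sum_coe_sort s.range (fun y => ENNReal.ofReal (μ.real (s ⁻¹' {y})) * A.indicator 1 y)]
  have hpre : s ⁻¹' A = s ⁻¹' (s.range.filter (· ∈ A) : Finset M) := by
    ext ω
    simp
  rw [hpre, ← sum_measure_preimage_singleton _ fun y _ => s.measurableSet_fiber y,
    Finset.sum_filter]
  refine Finset.sum_congr rfl fun y _ => ?_
  by_cases hy : y ∈ A <;> simp [hy]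

theorem fiber_measure_mem_stdSimplex (μ : Measure Ω) [IsProbabilityMeasure μ]
    (s : SimpleFunc Ω M) :
    (fun y : s.range => μ.real (s ⁻¹' {(y : M)})) ∈ stdSimplex ℝ s.range := by
  refine ⟨fun y => measureReal_nonneg, ?_⟩
  rw [Finset.sum_coe_sort s.range (fun y => μ.real (s ⁻¹' {y}))]
  have h := sum_measure_preimage_singleton (μ := μ) s.range fun y _ => s.measurableSet_fiber y
  have hpre : s ⁻¹' (s.range : Set M) = Set.univ := by
    ext ω
    simp
  rw [hpre, measure_univ] at h
  simp only [Measure.real]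
  rw [← ENNReal.toReal_sum fun y _ => measure_ne_top _ _, h, ENNReal.toReal_one]

variable [MetricSpace M]

/-- The approximants do not depend on `μ`, so the same sequence serves `P` and every `Q n ω`. -/
theorem tendsto_lintegral_edist_simpleFunc (hp : 1 ≤ p) {g : Ω → M} (hg : StronglyMeasurable g)
    {x : M} {s : ℕ → SimpleFunc Ω M} (hs : ∀ k ω, edist (s k ω) (g ω) ≤ edist x (g ω))
    (hlim : ∀ ω, Tendsto (fun k => s k ω) atTop (𝓝 (g ω))) {μ : Measure Ω}
    (hfin : ∫⁻ ω, edist x (g ω) ^ p ∂μ ≠ ∞) :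
    Tendsto (fun k => ∫⁻ ω, edist (s k ω) (g ω) ^ p ∂μ) atTop (𝓝 0) := by
  have hp0 : 0 < p := by linarith
  have h := tendsto_lintegral_of_dominated_convergence (μ := μ)
    (F := fun k ω => edist (s k ω) (g ω) ^ p) (f := fun _ => 0) (fun ω => edist x (g ω) ^ p)
    (fun k => ((s k).stronglyMeasurable.edist hg).measurable.pow_const p)
    (fun k => ae_of_all _ fun ω => ENNReal.rpow_le_rpow (hs k ω) hp0.le) hfin
    (ae_of_all _ fun ω => ?_)
  · simpa using h
  · have h1 := tendsto_iff_edist_tendsto_0.1 (hlim ω)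
    have h2 := ((ENNReal.continuous_rpow_const (y := p)).tendsto 0).comp h1
    rwa [ENNReal.zero_rpow_of_pos hp0] at h2

theorem lintegral_edist_simpleFunc_lt_top (hp : 1 ≤ p) {g : Ω → M} {x : M} {s : Ω → M}
    (hs : ∀ ω, edist (s ω) (g ω) ≤ edist x (g ω)) {μ : Measure Ω}
    (hfin : ∫⁻ ω, edist x (g ω) ^ p ∂μ < ∞) : ∫⁻ ω, edist x (s ω) ^ p ∂μ < ∞ := by
  have hp0 : 0 ≤ p := by linarith
  calc ∫⁻ ω, edist x (s ω) ^ p ∂μ ≤ ∫⁻ ω, 2 ^ p * edist x (g ω) ^ p ∂μ := by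
        refine lintegral_mono fun ω => ?_
        dsimp only
        rw [← ENNReal.mul_rpow_of_nonneg _ _ hp0]
        refine ENNReal.rpow_le_rpow ?_ hp0
        rw [two_mul]
        refine (edist_triangle x (g ω) (s ω)).trans (add_le_add le_rfl ?_)
        rw [edist_comm]
        exact hs ω
    _ = 2 ^ p * ∫⁻ ω, edist x (g ω) ^ p ∂μ :=
        lintegral_const_mul' _ _ (ENNReal.rpow_ne_top_of_nonneg hp0 ENNReal.ofNat_ne_top)
    _ < ∞ := ENNReal.mul_lt_top (ENNReal.rpow_lt_top_of_nonneg hp0 ENNReal.ofNat_ne_top) hfin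

variable [MeasurableSpace M] [BorelSpace M] {β : Measure M → M}

theorem IsContractiveBarycentricMap.edist_map_simpleFunc_rpow_le
    (hβ : IsContractiveBarycentricMap p β) (hp : 1 ≤ p) (s : SimpleFunc Ω M) (μ ν : Measure Ω)
    [IsProbabilityMeasure μ] [IsProbabilityMeasure ν] :
    edist (β (μ.map s)) (β (ν.map s)) ^ p ≤
      ENNReal.ofReal (∑ y : s.range, |μ.real (s ⁻¹' {(y : M)}) - ν.real (s ⁻¹' {(y : M)})|) *
        ∑ y : s.range, ∑ z : s.range, edist (y : M) z ^ p := by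
  rw [map_simpleFunc, map_simpleFunc]
  exact hβ.edist_atomicMeasure_rpow_le hp (fiber_measure_mem_stdSimplex μ s)
    (fiber_measure_mem_stdSimplex ν s) _

/-- The image of a simple function under all barycenters has bounded diameter. -/
theorem IsContractiveBarycentricMap.edist_map_simpleFunc_rpow_le_two
    (hβ : IsContractiveBarycentricMap p β) (hp : 1 ≤ p) (s : SimpleFunc Ω M) (μ ν : Measure Ω)
    [IsProbabilityMeasure μ] [IsProbabilityMeasure ν] :
    edist (β (μ.map s)) (β (ν.map s)) ^ p ≤
      2 * ∑ y : s.range, ∑ z : s.range, edist (y : M) z ^ p := by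
  refine (hβ.edist_map_simpleFunc_rpow_le hp s μ ν).trans ?_
  gcongr
  rw [show (2 : ℝ≥0∞) = ENNReal.ofReal 2 by simp]
  refine ENNReal.ofReal_le_ofReal ?_
  calc ∑ y : s.range, |μ.real (s ⁻¹' {(y : M)}) - ν.real (s ⁻¹' {(y : M)})|
      ≤ ∑ y : s.range, (μ.real (s ⁻¹' {(y : M)}) + ν.real (s ⁻¹' {(y : M)})) := by
        refine Finset.sum_le_sum fun y _ => ?_
        have h1 : 0 ≤ μ.real (s ⁻¹' {(y : M)}) := measureReal_nonneg
        have h2 : 0 ≤ ν.real (s ⁻¹' {(y : M)}) := measureReal_nonneg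
        rw [abs_le]
        constructor <;> linarith
    _ = 2 := by
        rw [Finset.sum_add_distrib, (fiber_measure_mem_stdSimplex μ s).2,
          (fiber_measure_mem_stdSimplex ν s).2]
        norm_num

/-- A continuous map on the simplex composed with the `𝓑`-measurable weights. -/
theorem stronglyMeasurable_condExpectation_simpleFunc {P : Measure Ω}
    {Q : Ω → Measure Ω} (hβ : IsContractiveBarycentricMap p β) (hp : 1 ≤ p)
    (hQ : IsDisintegration 𝓑 P Q) (s : SimpleFunc Ω M) :
    StronglyMeasurable[𝓑] (condExpectation β Q s) := by
  have := hQ.isProbabilityMeasure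
  let w : Ω → stdSimplex ℝ s.range := fun ω => ⟨_, fiber_measure_mem_stdSimplex (Q ω) s⟩
  have hw : Measurable[𝓑] w := by
    refine Measurable.subtype_mk ?_
    exact @measurable_pi_lambda _ _ _ 𝓑 _ _ fun y =>
      (hQ.measurable _ (s.measurableSet_fiber y)).ennreal_toReal
  have h : condExpectation β Q s =
      (fun a : stdSimplex ℝ s.range => β (atomicMeasure (a : s.range → ℝ) Subtype.val)) ∘ w :=
    funext fun ω => congrArg β (map_simpleFunc (Q ω) s)
  rw [h]
  exact (hβ.continuous_atomicMeasure hp _).stronglyMeasurable.comp_measurable hw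

theorem exists_simpleFunc_approx {g : Ω → M} (hg : StronglyMeasurable g) (x : M) :
    ∃ s : ℕ → SimpleFunc Ω M, (∀ k ω, edist (s k ω) (g ω) ≤ edist x (g ω)) ∧
      ∀ ω, Tendsto (fun k => s k ω) atTop (𝓝 (g ω)) := by
  -- Adjoining `x` makes it an admissible base point of `approxOn`, whence the bound by `edist x (g
  -- ω)`.
  let t : Set M := Set.range g ∪ {x}
  have ht : TopologicalSpace.IsSeparable t :=
    hg.isSeparable_range.union (Set.finite_singleton x).isSeparable
  have : TopologicalSpace.SeparableSpace t := ht.separableSpace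
  have hx : x ∈ t := Or.inr rfl
  exact ⟨SimpleFunc.approxOn g hg.measurable t x hx,
    fun k ω => SimpleFunc.edist_approxOn_le hg.measurable hx ω k,
    fun ω => SimpleFunc.tendsto_approxOn hg.measurable hx
      (subset_closure (Or.inl (Set.mem_range_self ω)))⟩

end SimpleFunctions

/-- A diagonal criterion for convergence to zero. -/
theorem tendsto_zero_of_le_of_tendsto {u : ℕ → ℝ≥0∞} {v : ℕ → ℕ → ℝ≥0∞} {c : ℕ → ℝ≥0∞}
    (huv : ∀ k n, u n ≤ v k n) (hv : ∀ k, Tendsto (v k) atTop (𝓝 (c k)))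
    (hc : Tendsto c atTop (𝓝 0)) : Tendsto u atTop (𝓝 0) := by
  rw [ENNReal.tendsto_nhds_zero]
  intro ε hε
  obtain ⟨k, hk⟩ := (hc.eventually_lt_const hε).exists
  filter_upwards [(hv k).eventually_lt_const hk] with n hn
  exact (huv k n).trans hn.le

/-- A `P`-null set is `Q ω`-null for almost every `ω`. Equality modulo the trimmed measure keeps the
exceptional set inside `𝓑`. -/
theorem condExpectation_congr {Ω M : Type*} {𝓑 mΩ : MeasurableSpace Ω} {P : Measure Ω}
    [MeasurableSpace M] {β : Measure M → M} [IsFiniteMeasure P] (h𝓑 : 𝓑 ≤ mΩ)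
    {Q : Ω → Measure Ω} (hQ : IsDisintegration 𝓑 P Q) {f g : Ω → M} (h : f =ᵐ[P] g) :
    condExpectation β Q f =ᵐ[P.trim h𝓑] condExpectation β Q g := by
  let N := toMeasurable P {ω | f ω ≠ g ω}
  have hN : MeasurableSet N := measurableSet_toMeasurable _ _
  have hPN : P N = 0 := by rw [measure_toMeasurable]; exact h
  have hQN : ∫⁻ ω, Q ω N ∂P.trim h𝓑 = 0 := by
    rw [lintegral_trim h𝓑 (hQ.measurable N hN)]
    have h1 := hQ.lintegral_lintegral h𝓑 (measurable_one.indicator hN)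
    simpa [lintegral_indicator_one hN, hPN] using h1
  rw [lintegral_eq_zero_iff (hQ.measurable N hN)] at hQN
  filter_upwards [hQN] with ω hω
  refine congrArg β (Measure.map_congr ?_)
  exact measure_mono_null (subset_toMeasurable P _) hω

/-! ### Integrability and convergence of the `β`-conditional expectations. -/

section Main

variable {Ω M : Type*} {𝓑 mΩ : MeasurableSpace Ω} {P : Measure Ω} [MetricSpace M] {p : ℝ}

theorem lpDist_triangle (hp : 1 ≤ p) {f g h : Ω → M} (hf : AEStronglyMeasurable f P)
    (hg : AEStronglyMeasurable g P) (hh : AEStronglyMeasurable h P) :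
    lpDist p P f h ≤ lpDist p P f g + lpDist p P g h := by
  refine le_trans ?_ (ENNReal.lintegral_Lp_add_le (hf.edist hg) (hg.edist hh) hp)
  refine ENNReal.rpow_le_rpow (lintegral_mono fun ω => ?_) (by positivity)
  exact ENNReal.rpow_le_rpow (edist_triangle _ _ _) (by linarith)

theorem lpDist_comm (f g : Ω → M) : lpDist p P f g = lpDist p P g f := by
  simp only [lpDist, edist_comm]

theorem lpDist_congr {f f' g g' : Ω → M} (hf : f =ᵐ[P] f') (hg : g =ᵐ[P] g') :
    lpDist p P f g = lpDist p P f' g' := by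
  refine congrArg (· ^ (1 / p)) (lintegral_congr_ae ?_)
  filter_upwards [hf, hg] with ω h1 h2
  rw [h1, h2]

theorem MemLpMetric.congr {f g : Ω → M} (hf : MemLpMetric p P f) (h : f =ᵐ[P] g) :
    MemLpMetric p P g := by
  obtain ⟨hm, x, hx⟩ := hf
  refine ⟨hm.congr h, x, ?_⟩
  exact (lintegral_congr_ae (h.fun_comp fun y => edist x y ^ p)).symm.trans_lt hx

variable [MeasurableSpace M] [BorelSpace M] {β : Measure M → M}

section Kernel

variable {Q : Ω → Measure Ω}

theorem edist_condExpectation_simpleFunc_rpow_le (hβ : IsContractiveBarycentricMap p β)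
    (hp : 1 ≤ p) (hQ : IsDisintegration 𝓑 P Q) {g : Ω → M} (hg : StronglyMeasurable g) {x : M}
    {s : SimpleFunc Ω M} (hs : ∀ ω, edist (s ω) (g ω) ≤ edist x (g ω)) {ω : Ω}
    (hfin : ∫⁻ ω', edist x (g ω') ^ p ∂Q ω < ∞) :
    edist (condExpectation β Q s ω) (condExpectation β Q g ω) ^ p ≤
      ∫⁻ ω', edist (s ω') (g ω') ^ p ∂Q ω := by
  have := hQ.isProbabilityMeasure
  exact hβ.edist_rpow_le hp (Q ω) s.stronglyMeasurable hg
    (lintegral_edist_simpleFunc_lt_top hp hs hfin) hfin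

/-- An a.e. limit of the `𝓑`-measurable expectations of simple functions; the moment bound compares
with the constant `x`. -/
theorem memLpMetric_condExpectation [IsFiniteMeasure P] (hβ : IsContractiveBarycentricMap p β)
    (hp : 1 ≤ p) (h𝓑 : 𝓑 ≤ mΩ) (hQ : IsDisintegration 𝓑 P Q) {g : Ω → M}
    (hg : StronglyMeasurable g) {x : M} (hfin : ∫⁻ ω, edist x (g ω) ^ p ∂P < ∞) :
    MemLpMetric p (P.trim h𝓑) (condExpectation β Q g) := by
  have := hQ.isProbabilityMeasure
  have hgm : Measurable fun ω => edist x (g ω) ^ p :=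
    (stronglyMeasurable_const.edist hg).measurable.pow_const p
  have htotal : ∫⁻ ω, ∫⁻ ω', edist x (g ω') ^ p ∂Q ω ∂P.trim h𝓑 < ∞ := by
    rw [lintegral_trim h𝓑 (hQ.measurable_lintegral hgm), hQ.lintegral_lintegral h𝓑 hgm]
    exact hfin
  have hae : ∀ᵐ ω ∂P.trim h𝓑, ∫⁻ ω', edist x (g ω') ^ p ∂Q ω < ∞ :=
    ae_lt_top (hQ.measurable_lintegral hgm) htotal.ne
  obtain ⟨s, hs, hlim⟩ := exists_simpleFunc_approx hg x
  refine ⟨aestronglyMeasurable_of_tendsto_ae atTop (fun k =>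
    (stronglyMeasurable_condExpectation_simpleFunc hβ hp hQ (s k)).aestronglyMeasurable) ?_,
    x, lt_of_le_of_lt (lintegral_mono_ae ?_) htotal⟩
  · filter_upwards [hae] with ω hω
    rw [tendsto_iff_edist_tendsto_0]
    exact tendsto_zero_of_rpow hp (tendsto_of_tendsto_of_tendsto_of_le_of_le tendsto_const_nhds
      (tendsto_lintegral_edist_simpleFunc hp hg hs hlim hω.ne) (fun _ => zero_le)
      fun k => edist_condExpectation_simpleFunc_rpow_le hβ hp hQ hg (hs k) hω)
  · filter_upwards [hae] with ω hω
    exact hβ.edist_const_rpow_le hp (Q ω) hg hω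

theorem lpDist_condExpectation_simpleFunc_le [IsFiniteMeasure P]
    (hβ : IsContractiveBarycentricMap p β)
    (hp : 1 ≤ p) (h𝓑 : 𝓑 ≤ mΩ) (hQ : IsDisintegration 𝓑 P Q) {g : Ω → M}
    (hg : StronglyMeasurable g) {x : M} (hfin : ∫⁻ ω, edist x (g ω) ^ p ∂P < ∞)
    {s : SimpleFunc Ω M} (hs : ∀ ω, edist (s ω) (g ω) ≤ edist x (g ω)) :
    lpDist p P (condExpectation β Q s) (condExpectation β Q g) ≤ lpDist p P s g := by
  have hgm : Measurable fun ω => edist x (g ω) ^ p :=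
    (stronglyMeasurable_const.edist hg).measurable.pow_const p
  refine ENNReal.rpow_le_rpow ?_ (by positivity)
  rw [← hQ.lintegral_lintegral h𝓑 ((s.stronglyMeasurable.edist hg).measurable.pow_const p)]
  refine lintegral_mono_ae ?_
  filter_upwards [hQ.ae_lintegral_lt_top h𝓑 hgm hfin.ne] with ω hω
  exact edist_condExpectation_simpleFunc_rpow_le hβ hp hQ hg hs hω

end Kernel

section Sequence

variable [IsProbabilityMeasure P] {𝓑 : ℕ∞ → MeasurableSpace Ω} {Q : ℕ∞ → Ω → Measure Ω}

theorem ae_tendsto_edist_condExpectation_simpleFunc (hβ : IsContractiveBarycentricMap p β)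
    (hp : 1 ≤ p) (h𝓑 : ∀ n, 𝓑 n ≤ mΩ)
    (hlim : (Monotone (fun n : ℕ => 𝓑 n) ∧ 𝓑 ⊤ = ⨆ n : ℕ, 𝓑 n) ∨
      (Antitone (fun n : ℕ => 𝓑 n) ∧ 𝓑 ⊤ = ⨅ n : ℕ, 𝓑 n))
    (hQ : ∀ n, IsDisintegration (𝓑 n) P (Q n)) (s : SimpleFunc Ω M) :
    ∀ᵐ ω ∂P, Tendsto
      (fun n : ℕ => edist (condExpectation β (Q n) s ω) (condExpectation β (Q ⊤) s ω) ^ p)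
      atTop (𝓝 0) := by
  have := fun n => (hQ n).isProbabilityMeasure
  have hfib : ∀ᵐ ω ∂P, ∀ y : s.range, Tendsto (fun n : ℕ => (Q n ω).real (s ⁻¹' {(y : M)}))
      atTop (𝓝 ((Q ⊤ ω).real (s ⁻¹' {(y : M)}))) := by
    refine ae_all_iff.2 fun y => ?_
    have hm := s.measurableSet_fiber (y : M)
    filter_upwards [ae_tendsto_lintegral_disintegration h𝓑 hlim hQ
      (measurable_one.indicator hm) (by simp [lintegral_indicator_one hm])] with ω hω
    simp only [lintegral_indicator_one hm] at hω
    exact (ENNReal.tendsto_toReal (measure_ne_top _ _)).comp hω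
  filter_upwards [hfib] with ω hω
  refine tendsto_of_tendsto_of_tendsto_of_le_of_le tendsto_const_nhds ?_ (fun _ => zero_le)
    fun n => hβ.edist_map_simpleFunc_rpow_le hp s (Q n ω) (Q ⊤ ω)
  have hsum : Tendsto (fun n : ℕ => ∑ y : s.range,
      |(Q n ω).real (s ⁻¹' {(y : M)}) - (Q ⊤ ω).real (s ⁻¹' {(y : M)})|) atTop (𝓝 0) := by
    have h := tendsto_finsetSum (Finset.univ : Finset s.range)
      fun y _ => ((hω y).sub_const ((Q ⊤ ω).real (s ⁻¹' {(y : M)}))).abs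
    simpa using h
  have h := ENNReal.Tendsto.mul_const (ENNReal.tendsto_ofReal hsum)
    (Or.inr (sum_edist_rpow_ne_top hp (Subtype.val : s.range → M)))
  simpa using h

theorem tendsto_lpDist_condExpectation_simpleFunc (hβ : IsContractiveBarycentricMap p β)
    (hp : 1 ≤ p) (h𝓑 : ∀ n, 𝓑 n ≤ mΩ)
    (hlim : (Monotone (fun n : ℕ => 𝓑 n) ∧ 𝓑 ⊤ = ⨆ n : ℕ, 𝓑 n) ∨
      (Antitone (fun n : ℕ => 𝓑 n) ∧ 𝓑 ⊤ = ⨅ n : ℕ, 𝓑 n))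
    (hQ : ∀ n, IsDisintegration (𝓑 n) P (Q n)) (s : SimpleFunc Ω M) :
    Tendsto (fun n : ℕ => lpDist p P (condExpectation β (Q n) s) (condExpectation β (Q ⊤) s))
      atTop (𝓝 0) := by
  have hp0 : 0 < p := by linarith
  have := fun n => (hQ n).isProbabilityMeasure
  have hsm : ∀ n : ℕ∞, StronglyMeasurable (condExpectation β (Q n) s) := fun n =>
    (stronglyMeasurable_condExpectation_simpleFunc hβ hp (hQ n) s).mono (h𝓑 n)
  have h := tendsto_lintegral_of_dominated_convergence (μ := P)
    (F := fun (n : ℕ) ω =>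
      edist (condExpectation β (Q n) s ω) (condExpectation β (Q ⊤) s ω) ^ p)
    (f := fun _ => 0) (fun _ => 2 * ∑ y : s.range, ∑ z : s.range, edist (y : M) z ^ p)
    (fun n => ((hsm n).edist (hsm ⊤)).measurable.pow_const p)
    (fun n => ae_of_all _ fun ω => hβ.edist_map_simpleFunc_rpow_le_two hp s (Q n ω) (Q ⊤ ω))
    (by
      rw [lintegral_const, measure_univ, mul_one]
      exact ENNReal.mul_ne_top ENNReal.ofNat_ne_top
        (sum_edist_rpow_ne_top hp (Subtype.val : s.range → M)))
    (ae_tendsto_edist_condExpectation_simpleFunc hβ hp h𝓑 hlim hQ s)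
  rw [lintegral_zero] at h
  have h2 := ((ENNReal.continuous_rpow_const (y := 1 / p)).tendsto 0).comp h
  rwa [ENNReal.zero_rpow_of_pos (by positivity)] at h2

theorem ae_tendsto_edist_condExpectation (hβ : IsContractiveBarycentricMap p β)
    (hp : 1 ≤ p) (h𝓑 : ∀ n, 𝓑 n ≤ mΩ)
    (hlim : (Monotone (fun n : ℕ => 𝓑 n) ∧ 𝓑 ⊤ = ⨆ n : ℕ, 𝓑 n) ∨
      (Antitone (fun n : ℕ => 𝓑 n) ∧ 𝓑 ⊤ = ⨅ n : ℕ, 𝓑 n))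
    (hQ : ∀ n, IsDisintegration (𝓑 n) P (Q n)) {g : Ω → M} (hg : StronglyMeasurable g) {x : M}
    (hfin : ∫⁻ ω, edist x (g ω) ^ p ∂P < ∞) :
    ∀ᵐ ω ∂P, Tendsto
      (fun n : ℕ => edist (condExpectation β (Q n) g ω) (condExpectation β (Q ⊤) g ω))
      atTop (𝓝 0) := by
  have hp0 : 0 < p := by linarith
  have hroot : Tendsto (fun t : ℝ≥0∞ => t ^ (1 / p)) (𝓝 0) (𝓝 0) := by
    have h := (ENNReal.continuous_rpow_const (y := 1 / p)).tendsto 0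
    rwa [ENNReal.zero_rpow_of_pos (by positivity)] at h
  have hgm : Measurable fun ω => edist x (g ω) ^ p :=
    (stronglyMeasurable_const.edist hg).measurable.pow_const p
  obtain ⟨s, hs, hslim⟩ := exists_simpleFunc_approx hg x
  have hsgm : ∀ k, Measurable fun ω => edist (s k ω) (g ω) ^ p := fun k =>
    ((s k).stronglyMeasurable.edist hg).measurable.pow_const p
  have hsgfin : ∀ k, ∫⁻ ω, edist (s k ω) (g ω) ^ p ∂P ≠ ∞ := fun k =>
    ((lintegral_mono fun ω => ENNReal.rpow_le_rpow (hs k ω) hp0.le).trans_lt hfin).ne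
  filter_upwards [
    ae_all_iff.2 fun n : ℕ => (hQ n).ae_lintegral_lt_top (h𝓑 n) hgm hfin.ne,
    (hQ ⊤).ae_lintegral_lt_top (h𝓑 ⊤) hgm hfin.ne,
    ae_all_iff.2 fun k => ae_tendsto_lintegral_disintegration h𝓑 hlim hQ (hsgm k) (hsgfin k),
    ae_all_iff.2 fun k => ae_tendsto_edist_condExpectation_simpleFunc hβ hp h𝓑 hlim hQ (s k)]
    with ω hfn hft hconv hsconv
  have hle : ∀ n : ℕ∞, ∫⁻ ω', edist x (g ω') ^ p ∂Q n ω < ∞ → ∀ k,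
      edist (condExpectation β (Q n) (s k) ω) (condExpectation β (Q n) g ω) ≤
        (∫⁻ ω', edist (s k ω') (g ω') ^ p ∂Q n ω) ^ (1 / p) := fun n hn k => by
    rw [one_div, ENNReal.le_rpow_inv_iff hp0]
    exact edist_condExpectation_simpleFunc_rpow_le hβ hp (hQ n) hg (hs k) hn
  -- Triangle inequality through `s k`: first `n → ∞` with `k` fixed, then `k → ∞`.
  refine tendsto_zero_of_le_of_tendsto
    (v := fun k n => (∫⁻ ω', edist (s k ω') (g ω') ^ p ∂Q n ω) ^ (1 / p) +
      (edist (condExpectation β (Q n) (s k) ω) (condExpectation β (Q ⊤) (s k) ω) +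
      (∫⁻ ω', edist (s k ω') (g ω') ^ p ∂Q ⊤ ω) ^ (1 / p)))
    (c := fun k => (∫⁻ ω', edist (s k ω') (g ω') ^ p ∂Q ⊤ ω) ^ (1 / p) +
      (0 + (∫⁻ ω', edist (s k ω') (g ω') ^ p ∂Q ⊤ ω) ^ (1 / p)))
    (fun k n => ?_) (fun k => ?_) ?_
  · refine (edist_triangle _ (condExpectation β (Q n) (s k) ω) _).trans (add_le_add ?_ ?_)
    · rw [edist_comm]
      exact hle n (hfn n) k
    · exact (edist_triangle _ (condExpectation β (Q ⊤) (s k) ω) _).trans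
        (add_le_add le_rfl (hle ⊤ hft k))
  · exact (((ENNReal.continuous_rpow_const (y := 1 / p)).tendsto _).comp (hconv k)).add
      ((tendsto_zero_of_rpow hp (hsconv k)).add tendsto_const_nhds)
  · have h := hroot.comp (tendsto_lintegral_edist_simpleFunc hp hg hs hslim hft.ne)
    simpa using h.add ((tendsto_const_nhds (x := (0 : ℝ≥0∞))).add h)

theorem tendsto_lpDist_condExpectation (hβ : IsContractiveBarycentricMap p β)
    (hp : 1 ≤ p) (h𝓑 : ∀ n, 𝓑 n ≤ mΩ)
    (hlim : (Monotone (fun n : ℕ => 𝓑 n) ∧ 𝓑 ⊤ = ⨆ n : ℕ, 𝓑 n) ∨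
      (Antitone (fun n : ℕ => 𝓑 n) ∧ 𝓑 ⊤ = ⨅ n : ℕ, 𝓑 n))
    (hQ : ∀ n, IsDisintegration (𝓑 n) P (Q n)) {g : Ω → M} (hg : StronglyMeasurable g) {x : M}
    (hfin : ∫⁻ ω, edist x (g ω) ^ p ∂P < ∞) :
    Tendsto (fun n : ℕ => lpDist p P (condExpectation β (Q n) g) (condExpectation β (Q ⊤) g))
      atTop (𝓝 0) := by
  obtain ⟨s, hs, hslim⟩ := exists_simpleFunc_approx hg x
  have hE : ∀ n : ℕ∞, AEStronglyMeasurable (condExpectation β (Q n) g) P := fun n =>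
    aestronglyMeasurable_of_aestronglyMeasurable_trim (h𝓑 n)
      (memLpMetric_condExpectation hβ hp (h𝓑 n) (hQ n) hg hfin).1
  have hS : ∀ (k : ℕ) (n : ℕ∞), AEStronglyMeasurable (condExpectation β (Q n) (s k)) P :=
    fun k n => ((stronglyMeasurable_condExpectation_simpleFunc hβ hp (hQ n) (s k)).mono
      (h𝓑 n)).aestronglyMeasurable
  -- The bound is uniform in `n`, so no convergence of the outer terms in `n` is needed.
  have hle : ∀ (k : ℕ) (n : ℕ∞), lpDist p P (condExpectation β (Q n) (s k))
      (condExpectation β (Q n) g) ≤ lpDist p P (s k) g := fun k n =>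
    lpDist_condExpectation_simpleFunc_le hβ hp (h𝓑 n) (hQ n) hg hfin (hs k)
  refine tendsto_zero_of_le_of_tendsto
    (v := fun k n => lpDist p P (s k) g + (lpDist p P (condExpectation β (Q n) (s k))
      (condExpectation β (Q ⊤) (s k)) + lpDist p P (s k) g))
    (c := fun k => lpDist p P (s k) g + (0 + lpDist p P (s k) g))
    (fun k n => ?_) (fun k => ?_) ?_
  · refine (lpDist_triangle hp (hE n) (hS k n) (hE ⊤)).trans (add_le_add ?_ ?_)
    · rw [lpDist_comm]
      exact hle k n
    · exact (lpDist_triangle hp (hS k n) (hS k ⊤) (hE ⊤)).trans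
        (add_le_add le_rfl (hle k ⊤))
  · exact tendsto_const_nhds.add ((tendsto_lpDist_condExpectation_simpleFunc hβ hp h𝓑 hlim hQ
      (s k)).add tendsto_const_nhds)
  · have h : Tendsto (fun k => lpDist p P (s k) g) atTop (𝓝 0) := by
      have h := ((ENNReal.continuous_rpow_const (y := 1 / p)).tendsto 0).comp
        (tendsto_lintegral_edist_simpleFunc hp hg hs hslim hfin.ne)
      rwa [ENNReal.zero_rpow_of_pos (by positivity)] at h
    simpa using h.add ((tendsto_const_nhds (x := (0 : ℝ≥0∞))).add h)

end Sequence

end Main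

end Barycentric

open Barycentric
theorem theorem3p1 {Ω M : Type*} [mΩ : MeasurableSpace Ω] [StandardBorelSpace Ω]
    (P : Measure Ω) [IsProbabilityMeasure P]
    [MetricSpace M] [CompleteSpace M] [MeasurableSpace M] [BorelSpace M]
    (p : ℝ) (hp : 1 ≤ p)
    (β : Measure M → M) (hβ : IsContractiveBarycentricMap p β)
    (𝓑 : ℕ∞ → MeasurableSpace Ω) (h𝓑 : ∀ n, 𝓑 n ≤ mΩ)
    (hlim : (Monotone (fun n : ℕ => 𝓑 n) ∧ 𝓑 ⊤ = ⨆ n : ℕ, 𝓑 n) ∨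
      (Antitone (fun n : ℕ => 𝓑 n) ∧ 𝓑 ⊤ = ⨅ n : ℕ, 𝓑 n))
    (Q : ℕ∞ → Ω → Measure Ω) (hQ : ∀ n, IsDisintegration (𝓑 n) P (Q n))
    (φ : Ω → M) (hφ : MemLpMetric p P φ) :
    (∀ n : ℕ∞, MemLpMetric p (P.trim (h𝓑 n)) (condExpectation β (Q n) φ)) ∧
    Tendsto (fun n : ℕ => lpDist p P (condExpectation β (Q n) φ) (condExpectation β (Q ⊤) φ))
      atTop (𝓝 0) ∧
    ∀ᵐ ω ∂P, Tendsto
      (fun n : ℕ => dist (condExpectation β (Q n) φ ω) (condExpectation β (Q ⊤) φ ω))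
      atTop (𝓝 0) := by
  obtain ⟨hφm, x, hx⟩ := hφ
  let g := hφm.mk φ
  have hg : StronglyMeasurable g := hφm.stronglyMeasurable_mk
  have hφg : φ =ᵐ[P] g := hφm.ae_eq_mk
  have hfin : ∫⁻ ω, edist x (g ω) ^ p ∂P < ∞ := by
    exact (lintegral_congr_ae (hφg.fun_comp fun y => edist x y ^ p)).symm.trans_lt hx
  -- For exceptional `ω`, `φ` may fail to be a.e. measurable for `Q n ω`, and `Measure.map` is then
  -- zero; such `ω` form a null set.
  have htrim : ∀ n, condExpectation β (Q n) φ =ᵐ[P.trim (h𝓑 n)] condExpectation β (Q n) g :=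
    fun n => condExpectation_congr (h𝓑 n) (hQ n) hφg
  have hP : ∀ n, condExpectation β (Q n) φ =ᵐ[P] condExpectation β (Q n) g :=
    fun n => ae_eq_of_ae_eq_trim (htrim n)
  refine ⟨fun n => (memLpMetric_condExpectation hβ hp (h𝓑 n) (hQ n) hg hfin).congr
    (htrim n).symm, ?_, ?_⟩
  · simp only [fun n : ℕ => lpDist_congr (p := p) (hP n) (hP ⊤)]
    exact tendsto_lpDist_condExpectation hβ hp h𝓑 hlim hQ hg hfin
  · filter_upwards [ae_all_iff.2 fun n : ℕ => hP n, hP ⊤,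
      ae_tendsto_edist_condExpectation hβ hp h𝓑 hlim hQ hg hfin] with ω h1 h2 h3
    simp only [h1, h2, dist_edist]
    exact (ENNReal.tendsto_toReal ENNReal.zero_ne_top).comp h3
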